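/- Let $k \ge 2$ and $a, b \ge 3$ be integers, and let $G = CB(k,a,b)$ be the cycle barbell: the graph on $n = a+b+k-2$ vertices obtained from a cycle $C_a$, a path $P_k$ on $k$ vertices and a cycle $C_b$ by identifying one end of $P_k$ with a vertex of $C_a$ and the other end of $P_k$ with a vertex of $C_b$. Consider the non-backtracking random walk on the vertices of $G$: from the starting vertex the first step goes to a uniformly chosen neighbour, and each later step goes from the current vertex to a uniformly chosen neighbour other than the vertex visited immediately before. Let $M_v^{(nb)}$ be the $n \times n$ matrix of its expected first hitting times: for $i \neq j$, $(M_v^{(nb)})_{ij}$ is the expected number of steps until the walk started at $i$ first visits $j$, and $(M_v^{(nb)})_{ii} = 0$. Let $\pi$ be the vector with $\pi_i = \deg(i) / \sum_{v} \deg(v)$. Then all these expected hitting times are finite, and \begin{align*} \pi^\top M_v^{(nb)} \pi ={}& \frac{13a^3 + 13b^3 + b^2(-87 + 60k) + a^2(-87 + 60b + 60k) + 2b(49 - 72k + 24k^2)}{24(-1 + a + b + k)^2} \\ &+ \frac{4(-9 + 20k - 15k^2 + 4k^3) + 2a\bigl(49 + 30b^2 - 72k + 24k^2 + 12b(-7 +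 4k)\bigr)}{24(-1 + a + b + k)^2}. \end{align*} -/

import Mathlib

open scoped Matrix ENNReal

namespace NBRW

noncomputable section

section Walk

variable {V : Type*} [Fintype V] [MeasurableSpace V] [DiscreteMeasurableSpace V]

/-- The uniform probability measure on the finite set `s`. If `s` is empty there is no vertex to
choose, and the point mass at `v` is used instead, so that the value is always a probability
measure. In a graph of minimum degree at least two this never happens below. -/
def uniformStep (s : Finset V) (v : V) : MeasureTheory.Measure V :=
  open scoped Classical in
  if h : s.Nonempty then (PMF.uniformOfFinset s h).toMeasure else MeasureTheory.Measure.dirac v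

instance (s : Finset V) (v : V) : MeasureTheory.IsProbabilityMeasure (uniformStep s v) := by
  unfold uniformStep
  split_ifs <;> infer_instance

/-- The law of the next vertex of the non-backtracking random walk on `G`, given the vertices
`x 0, …, x n` visited so far: for `n = 0`, uniform on the neighbours of `x 0`; for `n ≥ 1`, uniform
on the neighbours of `x n` other than `x (n - 1)`. -/
def nextVertexLaw (G : SimpleGraph V) :
    (n : ℕ) → ((i : Finset.Iic n) → V) → MeasureTheory.Measure V
  | 0, x =>
    open scoped Classical in
    uniformStep (G.neighborFinset (x ⟨0, by simp⟩)) (x ⟨0, by simp⟩)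
  | n + 1, x =>
    open scoped Classical in
    uniformStep ((G.neighborFinset (x ⟨n + 1, by simp⟩)).erase (x ⟨n, by simp⟩))
      (x ⟨n + 1, by simp⟩)

/-- The transition kernels of the non-backtracking random walk, from the past up to time `n` to
the vertex at time `n + 1`. -/
def stepKernel (G : SimpleGraph V) (n : ℕ) :
    ProbabilityTheory.Kernel ((i : Finset.Iic n) → V) V :=
  ProbabilityTheory.Kernel.ofFunOfCountable (nextVertexLaw G n)

instance (G : SimpleGraph V) (n : ℕ) : ProbabilityTheory.IsMarkovKernel (stepKernel G n) := by
  refine ⟨fun x => ?_⟩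
  change MeasureTheory.IsProbabilityMeasure (nextVertexLaw G n x)
  cases n <;> (unfold nextVertexLaw; infer_instance)

/-- The law, on the space of trajectories `ℕ → V`, of the non-backtracking random walk on the
vertices of `G` started at the vertex `i`. -/
def walkLaw (G : SimpleGraph V) (i : V) : MeasureTheory.Measure (ℕ → V) :=
  ProbabilityTheory.Kernel.trajMeasure (X := fun _ => V) (MeasureTheory.Measure.dirac i)
    (stepKernel G)

/-- The first time at which the trajectory `ω` is at `j` (`∞` if it never is). -/
def hittingTime (j : V) (ω : ℕ → V) : ℝ≥0∞ :=
  ⨅ (t : ℕ) (_ : ω t = j), (t : ℝ≥0∞)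

/-- The expected first hitting time of `j` by the non-backtracking random walk started at `i`. -/
def expectedHittingTime (G : SimpleGraph V) (i j : V) : ℝ≥0∞ :=
  ∫⁻ ω, hittingTime j ω ∂(walkLaw G i)

/-- The matrix `M_v^{nb}` of non-backtracking first hitting times, with zero diagonal. -/
def hittingMatrix (G : SimpleGraph V) : Matrix V V ℝ :=
  open scoped Classical in
  Matrix.of fun i j => if j = i then 0 else (expectedHittingTime G i j).toReal

end Walk

/-- The stationary distribution `π_i = deg(i) / vol(G)`, where `vol(G)` is the sum of all degrees. -/
def stationary {V : Type*} [Fintype V] (G : SimpleGraph V) (i : V) : ℝ :=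
  open scoped Classical in
  (G.degree i : ℝ) / ∑ v, (G.degree v : ℝ)

/-- The cycle barbell `CB(k, a, b)` on the vertices `0, …, a + b + k - 3`: the `a`-cycle on
`0, …, a - 1`, the path on the `k` vertices `a - 1, …, a + k - 2`, and the `b`-cycle on
`a + k - 2, …, a + b + k - 3`. Each cycle shares exactly one vertex, an end, with the path. -/
def cycleBarbell (k a b : ℕ) (hk : 2 ≤ k) (ha : 3 ≤ a) (hb : 3 ≤ b) :
    SimpleGraph (Fin (a + b + k - 2)) :=
  (SimpleGraph.cycleGraph a).map (fun i : Fin a => ⟨i, by omega⟩) ⊔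
  (SimpleGraph.pathGraph k).map (fun i : Fin k => ⟨a - 1 + i, by omega⟩) ⊔
  (SimpleGraph.cycleGraph b).map (fun i : Fin b => ⟨a + k - 2 + i, by omega⟩)

end

end NBRW

/-! The walk is Markov on directed edges. Suppose finite `h u v` satisfy the first-step equations
for the remaining time to `j` after a move from `u` to `v`. Telescoping them along the trajectory,
with `h` bounded because the graph is finite, gives that the expected hitting time from `i ≠ j` is 1
plus the mean of `h i w` over neighbours `w` (`IsRemainingTime.expectedHittingTime_eq`). So any
solution certifies both finiteness and the value.

Summing the edge equations gives a Kac-type formula for the edges leaving `j` (`sum_target`). With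
it, the degree-weighted column sum of the hitting matrix is exactly the sum of `h` over all directed
edges (`sum_degree_mul_hittingMatrix`), and the quantity sought is a degree-weighted sum of these
totals over `j`, divided by the squared volume.

For the barbell, with `p = a - 1`, `q = k - 1`, `m = b - 1`, the solutions are explicit: motion is
forced except at the two joints, and a walk entering a cycle without the target makes a geometric
number of turns, 2 on average. Targets on the second cycle follow by reflection. Each total is
quadratic in the position of the target, so the last sums are elementary. -/

namespace NBRW
open MeasureTheory ProbabilityTheory

/-! ### Hitting times from first-step equations on directed edges. -/

section HittingTimes

/-- The trajectory has not visited `j` up to time `n`. -/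
def avoids {V : Type*} (j : V) (n : ℕ) : Set (ℕ → V) := {ω | ∀ t ≤ n, ω t ≠ j}

theorem measurableSet_avoids {V : Type*} [MeasurableSpace V] [DiscreteMeasurableSpace V]
    (j : V) (n : ℕ) : MeasurableSet (avoids j n) := by
  have : avoids j n = ⋂ t, ⋂ _ : t ≤ n, (fun ω : ℕ → V => ω t) ⁻¹' {j}ᶜ := by
    ext ω; simp [avoids]
  rw [this]
  exact MeasurableSet.iInter fun t => MeasurableSet.iInter fun _ =>
    measurable_pi_apply t (MeasurableSet.of_discrete)

/-- Tail-sum formula, pointwise; when `j` is never visited both sides are `∞`. -/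
theorem hittingTime_eq_tsum {V : Type*} (j : V) (ω : ℕ → V) :
    hittingTime j ω = ∑' n, (avoids j n).indicator 1 ω := by
  classical
  by_cases hex : ∃ t, ω t = j
  · have h1 : ∀ n, (avoids j n).indicator (1 : (ℕ → V) → ℝ≥0∞) ω
        = if n < Nat.find hex then 1 else 0 := by
      intro n
      rw [Set.indicator_apply]
      refine if_congr ?_ rfl rfl
      rw [Nat.lt_find_iff]
      exact Iff.rfl
    simp_rw [h1]
    rw [tsum_eq_sum (s := Finset.range (Nat.find hex)) (by simp +contextual)]
    rw [Finset.sum_congr rfl (g := fun _ => (1 : ℝ≥0∞)) (by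
      intro x hx; rw [if_pos (Finset.mem_range.1 hx)])]
    simp only [Finset.sum_const, Finset.card_range, nsmul_eq_mul, mul_one]
    refine le_antisymm (iInf₂_le (f := fun (t : ℕ) (_ : ω t = j) => (t : ℝ≥0∞)) _
      (Nat.find_spec hex)) (le_iInf₂ fun t ht => ?_)
    exact_mod_cast Nat.find_min' hex ht
  · push Not at hex
    have h1 : ∀ n, (avoids j n).indicator (1 : (ℕ → V) → ℝ≥0∞) ω = 1 := fun n =>
      Set.indicator_of_mem (s := avoids j n) (fun t _ => hex t) _
    simp_rw [h1, ENNReal.tsum_const]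
    simp [hittingTime, hex]

variable {V : Type*} [Fintype V] [MeasurableSpace V] [DiscreteMeasurableSpace V]

theorem lintegral_uniformStep {s : Finset V} (hs : s.Nonempty) (v : V) (g : V → ℝ≥0∞) :
    ∫⁻ w, g w ∂(uniformStep s v) = (∑ w ∈ s, g w) / s.card := by
  classical
  rw [uniformStep, dif_pos hs, lintegral_fintype]
  simp_rw [PMF.toMeasure_apply_singleton _ _ (MeasurableSet.singleton _),
    PMF.uniformOfFinset_apply, mul_ite, mul_zero]
  rw [Finset.sum_ite_mem, Finset.univ_inter, ← Finset.sum_mul, ENNReal.div_eq_inv_mul, mul_comm]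

/-- The Ionescu-Tulcea construction makes the joint law of the past and the next vertex the
composition-product of the law of the past with the step kernel. -/
theorem lintegral_walkLaw_step (G : SimpleGraph V) (i : V) (n : ℕ)
    (f : ((t : Finset.Iic n) → V) → V → ℝ≥0∞) :
    ∫⁻ ω, f (fun t => ω t) (ω (n + 1)) ∂(walkLaw G i)
      = ∫⁻ ω, ∫⁻ y, f (fun t => ω t) y ∂(nextVertexLaw G n fun t => ω t) ∂(walkLaw G i) := by
  have hm := Kernel.map_frestrictLe_trajMeasure_compProd_eq_map_trajMeasure (X := fun _ => V)
    (μ₀ := Measure.dirac i) (κ := stepKernel G) (a := n)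
  have hf : Measurable (fun p : ((t : Finset.Iic n) → V) × V => f p.1 p.2) :=
    Measurable.of_discrete
  have h1 := lintegral_map (μ := walkLaw G i) hf
    (g := fun x => (Preorder.frestrictLe n x, x (n + 1))) (by fun_prop)
  have h2 := lintegral_map (μ := walkLaw G i) (f := fun x => ∫⁻ y, f x y ∂(stepKernel G n x))
    (g := Preorder.frestrictLe n) Measurable.of_discrete (by fun_prop)
  rw [walkLaw] at h1 h2 ⊢
  refine h1.symm.trans ?_
  rw [← hm, Measure.lintegral_compProd hf]
  exact h2

theorem walkLaw_map_zero (G : SimpleGraph V) (i : V) :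
    (walkLaw G i).map (fun ω => ω 0) = Measure.dirac i := by
  have h : (walkLaw G i).map (Preorder.frestrictLe (π := fun _ => V) 0)
      = (Measure.dirac i).map (MeasurableEquiv.piUnique fun _ : Finset.Iic 0 => V).symm := by
    rw [walkLaw, Kernel.trajMeasure, Measure.map_comp _ _ (by fun_prop),
      Kernel.traj_map_frestrictLe, Kernel.partialTraj_self, Measure.id_comp]
  have h2 := congrArg (Measure.map fun x : (Finset.Iic 0 → V) => x ⟨0, by simp⟩) h
  rw [Measure.map_map (by fun_prop) (by fun_prop), Measure.map_map (by fun_prop) (by fun_prop)]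
    at h2
  refine h2.trans ?_
  exact Measure.map_id

theorem walkLaw_ae_zero (G : SimpleGraph V) (i : V) : ∀ᵐ ω ∂(walkLaw G i), ω 0 = i := by
  have h : ∀ᵐ v ∂((walkLaw G i).map (fun ω => ω 0)), v = i := by
    rw [walkLaw_map_zero]
    exact (ae_dirac_iff MeasurableSet.of_discrete).2 rfl
  exact ae_of_ae_map (measurable_pi_apply 0).aemeasurable h

instance (G : SimpleGraph V) (i : V) : IsProbabilityMeasure (walkLaw G i) := by
  unfold walkLaw; infer_instance

open scoped Classical in
/-- `h u v` is a system of finite expected remaining times to `j` for the non-backtracking walk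
that has just moved from `u` to `v`. -/
structure IsRemainingTime (G : SimpleGraph V) (j : V) (h : V → V → ℝ≥0∞) : Prop where
  ne_top : ∀ u v, h u v ≠ ⊤
  target : ∀ u, h u j = 0
  step : ∀ u v, v ≠ j →
    h u v = 1 + ∫⁻ w, h v w ∂(uniformStep ((G.neighborFinset v).erase u) v)

/-- One telescoping step: where `ω (n + 1) ≠ j`, the equation for `h` splits off 1 and leaves a
conditional mean, which the step law turns into the value at the next edge. Where `ω (n + 1) = j`,
everything vanishes. -/
theorem IsRemainingTime.lintegral_avoids {G : SimpleGraph V} {j : V} {h : V → V → ℝ≥0∞}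
    (H : IsRemainingTime G j h) (i : V) (n : ℕ) :
    ∫⁻ ω, (avoids j n).indicator 1 ω * h (ω n) (ω (n + 1)) ∂(walkLaw G i)
      = walkLaw G i (avoids j (n + 1))
        + ∫⁻ ω, (avoids j (n + 1)).indicator 1 ω * h (ω (n + 1)) (ω (n + 2)) ∂(walkLaw G i) := by
  classical
  have key : ∀ ω : ℕ → V, (avoids j n).indicator 1 ω * h (ω n) (ω (n + 1))
      = (avoids j (n + 1)).indicator 1 ω + (avoids j (n + 1)).indicator 1 ω *
        ∫⁻ w, h (ω (n + 1)) w ∂(nextVertexLaw G (n + 1) fun t => ω t) := by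
    intro ω
    by_cases hj : ω (n + 1) = j
    · rw [hj, H.target, Set.indicator_of_notMem (s := avoids j (n + 1))
        (fun hω => hω (n + 1) le_rfl hj)]
      simp
    · have : ω ∈ avoids j n ↔ ω ∈ avoids j (n + 1) :=
        ⟨fun hω t ht => (Nat.le_succ_iff.1 ht).elim (hω t) (fun e => e ▸ hj),
          fun hω t ht => hω t (ht.trans n.le_succ)⟩
      rw [H.step _ _ hj]
      by_cases hω : ω ∈ avoids j n
      · rw [Set.indicator_of_mem hω, Set.indicator_of_mem (this.1 hω)]
        simp only [Pi.one_apply, one_mul]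
        rfl
      · rw [Set.indicator_of_notMem hω, Set.indicator_of_notMem (fun h' => hω (this.2 h'))]
        simp
  simp_rw [key]
  rw [lintegral_add_left (measurable_one.indicator (measurableSet_avoids j _)),
    lintegral_indicator_one (measurableSet_avoids j _)]
  congr 1
  -- The integrand is rewritten as a function of the past up to time `n + 1` and the next vertex.
  let f : ((t : Finset.Iic (n + 1)) → V) → V → ℝ≥0∞ := fun x y =>
    (if ∀ t, x t ≠ j then 1 else 0) * h (x ⟨n + 1, by simp⟩) y
  have hf : ∀ (ω : ℕ → V) y, f (fun t => ω t) y
      = (avoids j (n + 1)).indicator 1 ω * h (ω (n + 1)) y := by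
    intro ω y
    simp only [f, Set.indicator_apply, Pi.one_apply]
    congr 1
    refine if_congr ?_ rfl rfl
    simp [avoids]
  have h1 := lintegral_walkLaw_step G i (n + 1) f
  simp_rw [hf] at h1
  rw [h1]
  refine lintegral_congr fun ω => ?_
  rw [lintegral_const_mul _ Measurable.of_discrete]

theorem IsRemainingTime.expectedHittingTime_eq {G : SimpleGraph V} {j : V}
    {h : V → V → ℝ≥0∞} (H : IsRemainingTime G j h) {i : V} (hij : i ≠ j) :
    expectedHittingTime G i j =
      open scoped Classical in 1 + ∫⁻ w, h i w ∂(uniformStep (G.neighborFinset i) i) := by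
  classical
  set μ := walkLaw G i
  set A : ℕ → ℝ≥0∞ := fun n => μ (avoids j n)
  set B : ℕ → ℝ≥0∞ := fun n =>
    ∫⁻ ω, (avoids j n).indicator 1 ω * h (ω n) (ω (n + 1)) ∂μ
  have hAB : ∀ n, B n = A (n + 1) + B (n + 1) := H.lintegral_avoids i
  have hE : expectedHittingTime G i j = ∑' n, A n := by
    unfold expectedHittingTime
    simp_rw [hittingTime_eq_tsum]
    rw [lintegral_tsum fun n =>
      (measurable_one.indicator (measurableSet_avoids j n)).aemeasurable]
    exact tsum_congr fun n => lintegral_indicator_one (measurableSet_avoids j _)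
  have hA0 : A 0 = 1 := by
    refine (prob_compl_eq_zero_iff (measurableSet_avoids j 0)).1 ?_
    refine measure_mono_null ?_ (walkLaw_ae_zero G i)
    intro ω hω h0
    refine hω fun t ht => ?_
    rw [Nat.le_zero.1 ht]
    exact fun e => hij (h0.symm.trans e)
  have hB0 : B 0 = ∫⁻ w, h i w ∂(uniformStep (G.neighborFinset i) i) := by
    have h1 := lintegral_walkLaw_step G i 0 (fun x y => h (x ⟨0, by simp⟩) y)
    have h2 : B 0 = ∫⁻ ω, h (ω 0) (ω 1) ∂μ := by
      refine lintegral_congr_ae ?_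
      filter_upwards [walkLaw_ae_zero G i] with ω hω
      rw [Set.indicator_of_mem, Pi.one_apply, one_mul]
      intro t ht
      rw [Nat.le_zero.1 ht, hω]
      exact hij
    rw [h2]
    refine h1.trans ?_
    have h3 : ∫⁻ ω, ∫⁻ y, h (ω 0) y ∂(nextVertexLaw G 0 fun t => ω t) ∂μ
        = ∫⁻ _, ∫⁻ w, h i w ∂(uniformStep (G.neighborFinset i) i) ∂μ := by
      refine lintegral_congr_ae ?_
      filter_upwards [walkLaw_ae_zero G i] with ω hω
      have h4 : ∀ v, v = i → ∫⁻ w, h v w ∂(uniformStep (G.neighborFinset v) v)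
          = ∫⁻ w, h i w ∂(uniformStep (G.neighborFinset i) i) := by
        rintro _ rfl; rfl
      exact h4 _ hω
    refine h3.trans ?_
    rw [lintegral_const, measure_univ, mul_one]
  have hsum : ∀ n, B 0 = ∑ m ∈ Finset.range n, A (m + 1) + B n := by
    intro n
    induction n with
    | zero => simp
    | succ n ih => rw [ih, hAB n, Finset.sum_range_succ, add_assoc]
  -- Boundedness removes the remainder: `B 0 < ∞` makes `A` summable, so `A` tends to 0, and `B n ≤
  -- A n * C` follows it.
  obtain ⟨C, hC, hCtop⟩ : ∃ C : ℝ≥0∞, (∀ u v, h u v ≤ C) ∧ C ≠ ⊤ :=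
    ⟨∑ u, ∑ v, h u v, fun u v =>
      (Finset.single_le_sum (f := fun v => h u v) (by simp) (Finset.mem_univ v)).trans
        (Finset.single_le_sum (f := fun u => ∑ v, h u v) (by simp) (Finset.mem_univ u)),
      by simp [ENNReal.sum_eq_top, H.ne_top]⟩
  have hBC : ∀ n, B n ≤ A n * C := by
    intro n
    calc B n ≤ ∫⁻ ω, (avoids j n).indicator 1 ω * C ∂μ :=
          lintegral_mono fun ω => mul_le_mul_right (hC _ _) _
      _ = A n * C := by
          rw [lintegral_mul_const _ (measurable_one.indicator (measurableSet_avoids j n)),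
            lintegral_indicator_one (measurableSet_avoids j _)]
  have hle : ∑' m, A (m + 1) ≤ B 0 := by
    refine ENNReal.tsum_le_of_sum_range_le fun n => ?_
    rw [hsum n]
    exact le_self_add
  have hB0top : B 0 ≠ ⊤ := by
    refine ne_top_of_le_ne_top hCtop ((hBC 0).trans ?_)
    rw [hA0, one_mul]
  have hAlim : Filter.Tendsto (fun n => A (n + 1)) Filter.atTop (nhds 0) :=
    ENNReal.tendsto_atTop_zero_of_tsum_ne_top (ne_top_of_le_ne_top hB0top hle)
  have hBlim : Filter.Tendsto (fun n => B (n + 1)) Filter.atTop (nhds 0) := by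
    refine tendsto_of_tendsto_of_tendsto_of_le_of_le tendsto_const_nhds
      (h := fun n => A (n + 1) * C) ?_ (fun _ => zero_le) (fun n => hBC (n + 1))
    simpa using ENNReal.Tendsto.mul_const hAlim (Or.inr hCtop)
  have hlim : Filter.Tendsto (fun n => ∑ m ∈ Finset.range (n + 1), A (m + 1) + B (n + 1))
      Filter.atTop (nhds (∑' m, A (m + 1) + 0)) :=
    ((Filter.tendsto_add_atTop_iff_nat 1).2
      (ENNReal.tendsto_nat_tsum fun m => A (m + 1))).add hBlim
  have hfin : ∑' m, A (m + 1) = B 0 := by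
    simp_rw [← hsum, add_zero] at hlim
    exact tendsto_nhds_unique hlim tendsto_const_nhds
  rw [hE, tsum_eq_zero_add' ENNReal.summable, hfin, hA0, hB0]

end HittingTimes
end NBRW

/-! ### Real edge solutions and weighted column sums. -/

namespace NBRW
open MeasureTheory ProbabilityTheory

section RealSolutions

variable {V : Type*} [Fintype V]

open scoped Classical in
/-- `h u v`, for adjacent `u` and `v`, is a nonnegative real solution of the equations for the
expected remaining time to `j` after a non-backtracking step from `u` to `v`. -/
structure IsEdgeSolution (G : SimpleGraph V) (j : V) (h : V → V → ℝ) : Prop where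
  two_le_degree : ∀ v, 2 ≤ G.degree v
  nonneg : ∀ u v, G.Adj u v → 0 ≤ h u v
  target : ∀ u, G.Adj u j → h u j = 0
  step : ∀ u v, G.Adj u v → v ≠ j →
    ((G.degree v : ℝ) - 1) * (h u v - 1) = ∑ w ∈ G.neighborFinset v, h v w - h v u

namespace IsEdgeSolution

variable {G : SimpleGraph V} {j : V} {h : V → V → ℝ}

-- Summed over the edges into `v ≠ j`, the step equations say that incoming sum = degree + outgoing
-- sum, after cancelling `deg v - 1 > 0`. Over all vertices, incoming and outgoing sums agree in
-- total, and nothing comes in at `j`; what remains is the outgoing sum at `j`.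
open scoped Classical in
theorem sum_target (H : IsEdgeSolution G j h) :
    ∑ w ∈ G.neighborFinset j, h j w = ∑ v, (G.degree v : ℝ) - G.degree j := by
  have sw : ∀ f : V → V → ℝ, ∑ v, ∑ u ∈ G.neighborFinset v, f u v
      = ∑ u, ∑ v ∈ G.neighborFinset u, f u v := fun f => by
    refine Finset.sum_comm' fun x y => ?_
    simp [G.adj_comm]
  have h1 : ∀ v, ∑ u ∈ G.neighborFinset v, h u v = if v = j then 0 else
      (G.degree v : ℝ) + ∑ w ∈ G.neighborFinset v, h v w := by
    intro v
    split_ifs with hv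
    · subst hv
      exact Finset.sum_eq_zero fun u hu => H.target u ((G.mem_neighborFinset _ _).1 hu).symm
    · have hd : (0 : ℝ) < (G.degree v : ℝ) - 1 := by
        have : (2 : ℝ) ≤ G.degree v := by exact_mod_cast H.two_le_degree v
        linarith
      have h2 : ∑ u ∈ G.neighborFinset v, ((G.degree v : ℝ) - 1) * (h u v - 1)
          = ∑ u ∈ G.neighborFinset v, (∑ w ∈ G.neighborFinset v, h v w - h v u) :=
        Finset.sum_congr rfl fun u hu =>
          H.step u v ((G.mem_neighborFinset _ _).1 hu).symm hv
      rw [← Finset.mul_sum, Finset.sum_sub_distrib, Finset.sum_sub_distrib, Finset.sum_const,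
        Finset.sum_const, G.card_neighborFinset_eq_degree, nsmul_eq_mul, nsmul_eq_mul,
        mul_one] at h2
      refine mul_left_cancel₀ hd.ne' ?_
      linear_combination h2
  have h3 := sw h
  simp_rw [h1] at h3
  rw [← Finset.add_sum_erase _ _ (Finset.mem_univ j), if_pos rfl,
    Finset.sum_congr rfl (g := fun v => (G.degree v : ℝ) + ∑ w ∈ G.neighborFinset v, h v w)
      (fun v hv => if_neg (Finset.ne_of_mem_erase hv)), Finset.sum_add_distrib] at h3
  have h4 := Finset.add_sum_erase Finset.univ (fun v => (G.degree v : ℝ)) (Finset.mem_univ j)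
  have h5 := Finset.add_sum_erase Finset.univ (fun v => ∑ w ∈ G.neighborFinset v, h v w)
    (Finset.mem_univ j)
  linarith

variable [MeasurableSpace V] [DiscreteMeasurableSpace V]

-- `h` is constrained only on edges, whereas `IsRemainingTime` concerns all pairs. Defining `k`
-- everywhere by one application of the recursion extends `h`, since the recursion only looks at
-- edges out of `v`.
open scoped Classical in
theorem isRemainingTime (H : IsEdgeSolution G j h) :
    ∃ k : V → V → ℝ≥0∞, IsRemainingTime G j k ∧
      ∀ u v, G.Adj u v → k u v = ENNReal.ofReal (h u v) := by
  let k : V → V → ℝ≥0∞ := fun u v => if v = j then 0 else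
    1 + ∫⁻ w, ENNReal.ofReal (h v w) ∂(uniformStep ((G.neighborFinset v).erase u) v)
  have hne : ∀ u v, ((G.neighborFinset v).erase u).Nonempty := by
    intro u v
    rw [← Finset.card_pos]
    have := Finset.pred_card_le_card_erase (s := G.neighborFinset v) (a := u)
    have h2 := H.two_le_degree v
    rw [G.card_neighborFinset_eq_degree] at this
    omega
  have hk : ∀ u v, G.Adj u v → k u v = ENNReal.ofReal (h u v) := by
    intro u v huv
    by_cases hv : v = j
    · subst hv
      simp [k, H.target u huv]
    · have hu : u ∈ G.neighborFinset v := (G.mem_neighborFinset _ _).2 huv.symm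
      have hd := H.two_le_degree v
      have hd' : (2 : ℝ) ≤ G.degree v := by exact_mod_cast hd
      have hs := H.step u v huv hv
      have hnn : 0 ≤ ∑ w ∈ (G.neighborFinset v).erase u, h v w :=
        Finset.sum_nonneg fun w hw =>
          H.nonneg v w ((G.mem_neighborFinset _ _).1 (Finset.mem_of_mem_erase hw))
      rw [← Finset.add_sum_erase _ _ hu] at hs
      simp only [k, if_neg hv]
      rw [lintegral_uniformStep (hne u v), Finset.card_erase_of_mem hu,
        G.card_neighborFinset_eq_degree, ← ENNReal.ofReal_sum_of_nonneg fun w hw =>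
          H.nonneg v w ((G.mem_neighborFinset _ _).1 (Finset.mem_of_mem_erase hw)),
        ← ENNReal.ofReal_natCast, ← ENNReal.ofReal_div_of_pos (by
          rw [Nat.cast_sub (by omega)]; push_cast; linarith),
        ← ENNReal.ofReal_one, ← ENNReal.ofReal_add zero_le_one (by positivity),
        Nat.cast_sub (by omega)]
      congr 1
      push_cast
      have : (G.degree v : ℝ) - 1 ≠ 0 := by linarith
      field_simp
      linarith
  refine ⟨k, ⟨fun u v => ?_, fun u => by simp [k], fun u v hv => ?_⟩, hk⟩
  · by_cases hv : v = j
    · simp [k, hv]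
    · simp only [k, if_neg hv]
      rw [lintegral_uniformStep (hne u v)]
      refine ENNReal.add_ne_top.2 ⟨ENNReal.one_ne_top, ENNReal.div_ne_top ?_ ?_⟩
      · simp [ENNReal.sum_eq_top]
      · exact_mod_cast (Finset.card_pos.2 (hne u v)).ne'
  · simp only [k, if_neg hv]
    rw [lintegral_uniformStep (hne u v), lintegral_uniformStep (hne u v)]
    congr 2
    refine Finset.sum_congr rfl fun w hw => ?_
    exact (hk v w ((G.mem_neighborFinset _ _).1 (Finset.mem_of_mem_erase hw))).symm

open scoped Classical in
theorem expectedHittingTime_eq (H : IsEdgeSolution G j h) {i : V} (hij : i ≠ j) :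
    expectedHittingTime G i j
      = ENNReal.ofReal (1 + (∑ w ∈ G.neighborFinset i, h i w) / G.degree i) := by
  obtain ⟨k, hk, hkh⟩ := H.isRemainingTime
  have hd := H.two_le_degree i
  have hnn : ∀ w ∈ G.neighborFinset i, 0 ≤ h i w := fun w hw =>
    H.nonneg i w ((G.mem_neighborFinset _ _).1 hw)
  rw [hk.expectedHittingTime_eq hij, lintegral_uniformStep
    (Finset.card_pos.1 (by rw [G.card_neighborFinset_eq_degree]; omega)),
    G.card_neighborFinset_eq_degree,
    Finset.sum_congr rfl fun w hw => hkh i w ((G.mem_neighborFinset _ _).1 hw),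
    ← ENNReal.ofReal_sum_of_nonneg hnn, ← ENNReal.ofReal_natCast,
    ← ENNReal.ofReal_div_of_pos (by exact_mod_cast (by omega : 0 < G.degree i)),
    ← ENNReal.ofReal_one, ← ENNReal.ofReal_add zero_le_one
      (div_nonneg (Finset.sum_nonneg hnn) (Nat.cast_nonneg _))]

theorem expectedHittingTime_ne_top (H : IsEdgeSolution G j h) (i : V) :
    expectedHittingTime G i j ≠ ⊤ := by
  classical
  by_cases hij : i = j
  · subst hij
    have h0 : hittingTime i =ᵐ[walkLaw G i] 0 := by
      filter_upwards [walkLaw_ae_zero G i] with ω hω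
      refine le_antisymm ((iInf₂_le (f := fun (t : ℕ) (_ : ω t = i) => (t : ℝ≥0∞)) 0 hω).trans ?_)
        zero_le
      simp
    rw [expectedHittingTime, lintegral_congr_ae h0]
    simp
  · rw [H.expectedHittingTime_eq hij]
    exact ENNReal.ofReal_ne_top

-- For `i ≠ j` the summand is `deg i` plus the outgoing sum at `i`. The outgoing sum missing at `j`
-- equals the sum of these degrees, by `sum_target`.
open scoped Classical in
theorem sum_degree_mul_hittingMatrix (H : IsEdgeSolution G j h) :
    ∑ i, (G.degree i : ℝ) * hittingMatrix G i j = ∑ u, ∑ w ∈ G.neighborFinset u, h u w := by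
  have h1 : ∀ i ∈ Finset.univ.erase j, (G.degree i : ℝ) * hittingMatrix G i j
      = G.degree i + ∑ w ∈ G.neighborFinset i, h i w := by
    intro i hi
    have hij := Finset.ne_of_mem_erase hi
    have hd : (2 : ℝ) ≤ G.degree i := by exact_mod_cast H.two_le_degree i
    have hnn : 0 ≤ ∑ w ∈ G.neighborFinset i, h i w := Finset.sum_nonneg fun w hw =>
      H.nonneg i w ((G.mem_neighborFinset _ _).1 hw)
    rw [hittingMatrix, Matrix.of_apply, if_neg hij.symm, H.expectedHittingTime_eq hij,
      ENNReal.toReal_ofReal (by positivity)]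
    field_simp
  have h2 : hittingMatrix G j j = 0 := by simp [hittingMatrix]
  have h4 := Finset.add_sum_erase Finset.univ (fun v => (G.degree v : ℝ)) (Finset.mem_univ j)
  have h5 := Finset.add_sum_erase Finset.univ (fun v => ∑ w ∈ G.neighborFinset v, h v w)
    (Finset.mem_univ j)
  have h6 := H.sum_target
  rw [← Finset.add_sum_erase _ _ (Finset.mem_univ j), h2, Finset.sum_congr rfl h1,
    Finset.sum_add_distrib]
  linarith

end IsEdgeSolution

open scoped Classical in
theorem stationary_hittingMatrix [MeasurableSpace V] [DiscreteMeasurableSpace V]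
    {G : SimpleGraph V} {h : V → V → V → ℝ}
    (H : ∀ j, IsEdgeSolution G j (h j)) :
    stationary G ⬝ᵥ (hittingMatrix G *ᵥ stationary G)
      = (∑ j, (G.degree j : ℝ) * ∑ u, ∑ w ∈ G.neighborFinset u, h j u w)
        / (∑ v, (G.degree v : ℝ)) ^ 2 := by
  simp only [dotProduct, Matrix.mulVec, stationary]
  simp_rw [← (H _).sum_degree_mul_hittingMatrix, Finset.mul_sum]
  rw [Finset.sum_comm, Finset.sum_div]
  refine Finset.sum_congr rfl fun j _ => ?_
  rw [Finset.sum_div]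
  refine Finset.sum_congr rfl fun i _ => ?_
  ring

end RealSolutions
end NBRW

/-! ### Adjacency in the cycle barbell. -/

namespace NBRW
theorem cycleBarbell_adj (k a b : ℕ) (hk : 2 ≤ k) (ha : 3 ≤ a) (hb : 3 ≤ b)
    (u v : Fin (a + b + k - 2)) :
    (cycleBarbell k a b hk ha hb).Adj u v ↔
      (v : ℕ) = u + 1 ∨ (u : ℕ) = v + 1 ∨ ((u : ℕ) = 0 ∧ (v : ℕ) + 1 = a) ∨
      ((u : ℕ) + 1 = a ∧ (v : ℕ) = 0) ∨
      ((u : ℕ) + 2 = a + k ∧ (v : ℕ) + 3 = a + b + k) ∨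
      ((u : ℕ) + 3 = a + b + k ∧ (v : ℕ) + 2 = a + k) := by
  have cyc : ∀ (n : ℕ), 3 ≤ n → ∀ x y : Fin n, (SimpleGraph.cycleGraph n).Adj x y ↔
      (y : ℕ) = x + 1 ∨ (x : ℕ) = y + 1 ∨ ((x : ℕ) = 0 ∧ (y : ℕ) + 1 = n) ∨
      ((x : ℕ) + 1 = n ∧ (y : ℕ) = 0) := by
    intro n hn x y
    rw [SimpleGraph.cycleGraph_adj']
    have e : ∀ x y : Fin n, (x - y).val = 1 ↔ (x : ℕ) = y + 1 ∨ ((x : ℕ) = 0 ∧ (y : ℕ) + 1 = n) := by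
      intro x y
      have hx := x.2
      have hy := y.2
      rw [Fin.sub_def]
      simp only
      by_cases h : (y : ℕ) ≤ x
      · rw [show n - (y : ℕ) + x = (x - y) + n by omega, Nat.add_mod_right,
          Nat.mod_eq_of_lt (by omega)]
        omega
      · rw [Nat.mod_eq_of_lt (by omega)]
        omega
    rw [e, e]
    omega
  simp only [cycleBarbell, SimpleGraph.sup_adj, SimpleGraph.map_adj', cyc a ha, cyc b hb,
    SimpleGraph.pathGraph_adj, ne_eq, Fin.ext_iff]
  have hu := u.2
  have hv := v.2
  constructor
  · rintro ((⟨-, x, y, h, hx, hy⟩ | ⟨-, x, y, h, hx, hy⟩) | ⟨-, x, y, h, hx, hy⟩) <;>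
    (have := x.2; have := y.2; omega)
  · intro h
    -- An edge inside neither cycle's vertex range joins consecutive vertices of the path.
    by_cases h1 : (u : ℕ) < a ∧ (v : ℕ) < a
    · exact Or.inl (Or.inl ⟨by omega, ⟨u, h1.1⟩, ⟨v, h1.2⟩, by simp only; omega, rfl, rfl⟩)
    by_cases h2 : a + k - 2 ≤ (u : ℕ) ∧ a + k - 2 ≤ (v : ℕ)
    · exact Or.inr ⟨by omega, ⟨u - (a + k - 2), by omega⟩, ⟨v - (a + k - 2), by omega⟩,
        by simp only; omega, by simp only; omega, by simp only; omega⟩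
    · exact Or.inl (Or.inr ⟨by omega, ⟨u - (a - 1), by omega⟩, ⟨v - (a - 1), by omega⟩,
        by simp only; omega, by simp only; omega, by simp only; omega⟩)
end NBRW

/-! ### Edge equations in coordinates, and reflection. -/

namespace NBRW

section EdgeTimes

/-- Adjacency in the barbell with cycles `0, …, p` and `p + q, …, p + q + m`: a path on
`0, …, p + q + m` together with the chords `{0, p}` and `{p + q, p + q + m}`. -/
def BarbellAdj (p q m u v : ℕ) : Prop :=
  v = u + 1 ∨ u = v + 1 ∨ (u = 0 ∧ v = p) ∨ (u = p ∧ v = 0) ∨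
    (u = p + q ∧ v = p + q + m) ∨ (u = p + q + m ∧ v = p + q)

/-- A real number for every directed edge of a barbell: `right v` for `(v, v + 1)`, `left v` for
`(v + 1, v)`, and one for each direction of the two chords. -/
structure EdgeTimes where
  right : ℕ → ℝ
  left : ℕ → ℝ
  leftIn : ℝ
  leftOut : ℝ
  rightOut : ℝ
  rightIn : ℝ

namespace EdgeTimes

/-- The value of `T` at the directed edge `(u, v)`: `leftIn` at `(0, p)`, `leftOut` at `(p, 0)`,
`rightOut` at `(p + q, p + q + m)`, `rightIn` at `(p + q + m, p + q)`. -/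
def time (p q m : ℕ) (T : EdgeTimes) (u v : ℕ) : ℝ :=
  if v = u + 1 then T.right u else if u = v + 1 then T.left v
  else if u = 0 ∧ v = p then T.leftIn else if u = p ∧ v = 0 then T.leftOut
  else if u = p + q ∧ v = p + q + m then T.rightOut else T.rightIn

/-- The equations for the expected remaining times to `j` on the barbell. -/
structure IsSolution (p q m j : ℕ) (T : EdgeTimes) : Prop where
  right_nonneg : ∀ v < p + q + m, 0 ≤ T.right v
  left_nonneg : ∀ v < p + q + m, 0 ≤ T.left v
  leftIn_nonneg : 0 ≤ T.leftIn
  leftOut_nonneg : 0 ≤ T.leftOut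
  rightOut_nonneg : 0 ≤ T.rightOut
  rightIn_nonneg : 0 ≤ T.rightIn
  right_target : ∀ v, v + 1 = j → T.right v = 0
  left_target : j < p + q + m → T.left j = 0
  leftIn_target : j = p → T.leftIn = 0
  leftOut_target : j = 0 → T.leftOut = 0
  rightOut_target : j = p + q + m → T.rightOut = 0
  rightIn_target : j = p + q → T.rightIn = 0
  right_step : ∀ v, v + 1 ≠ j → v + 1 < p + q + m → v + 1 ≠ p → v + 1 ≠ p + q →
    T.right v = 1 + T.right (v + 1)
  left_step : ∀ v, v + 1 ≠ j → v + 1 < p + q + m → v + 1 ≠ p → v + 1 ≠ p + q →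
    T.left (v + 1) = 1 + T.left v
  right_first : ∀ v, v + 1 = p → p ≠ j → T.right v = 1 + (T.right p + T.leftOut) / 2
  left_first : ∀ v, v + 1 = p → p ≠ j → T.left p = 1 + (T.left v + T.leftOut) / 2
  leftIn_step : ∀ v, v + 1 = p → p ≠ j → T.leftIn = 1 + (T.left v + T.right p) / 2
  leftOut_step : 0 ≠ j → T.leftOut = 1 + T.right 0
  left_zero : 0 ≠ j → T.left 0 = 1 + T.leftIn
  right_second : ∀ v, v + 1 = p + q → p + q ≠ j →
    T.right v = 1 + (T.right (p + q) + T.rightOut) / 2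
  left_second : ∀ v, v + 1 = p + q → p + q ≠ j →
    T.left (p + q) = 1 + (T.left v + T.rightOut) / 2
  rightIn_step : ∀ v, v + 1 = p + q → p + q ≠ j →
    T.rightIn = 1 + (T.left v + T.right (p + q)) / 2
  rightOut_step : ∀ v, v + 1 = p + q + m → p + q + m ≠ j → T.rightOut = 1 + T.left v
  right_last : ∀ v, v + 1 = p + q + m → p + q + m ≠ j → T.right v = 1 + T.rightIn

/-- The sum of the values at all directed edges. -/
def total (p q m : ℕ) (T : EdgeTimes) : ℝ :=
  ∑ v ∈ Finset.range (p + q + m), (T.right v + T.left v)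
    + T.leftIn + T.leftOut + T.rightOut + T.rightIn

/-- The image of `T` under the reflection `v ↦ p + q + m - v`. -/
def reflect (p q m : ℕ) (T : EdgeTimes) : EdgeTimes where
  right v := T.left (p + q + m - 1 - v)
  left v := T.right (p + q + m - 1 - v)
  leftIn := T.rightIn
  leftOut := T.rightOut
  rightOut := T.leftOut
  rightIn := T.leftIn

theorem total_reflect (p q m : ℕ) (T : EdgeTimes) :
    (T.reflect p q m).total m q p = T.total p q m := by
  unfold total
  rw [← Finset.sum_range_reflect (fun v => T.right v + T.left v) (p + q + m),
    show m + q + p = p + q + m by omega]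
  simp only [reflect, add_comm (T.left _)]
  ring

/-- Reflection exchanges the cycles and the directions, so targets on the second cycle reduce to
targets on the first. -/
theorem IsSolution.reflect {p q m j : ℕ} {T : EdgeTimes} (H : T.IsSolution p q m j)
    (hp : 0 < p) (hq : 0 < q) (hm : 0 < m) (hj : j ≤ p + q + m) :
    (T.reflect p q m).IsSolution m q p (p + q + m - j) := by
  constructor <;> simp only [EdgeTimes.reflect]
  · exact fun v hv => H.left_nonneg _ (by omega)
  · exact fun v hv => H.right_nonneg _ (by omega)
  · exact H.rightIn_nonneg
  · exact H.rightOut_nonneg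
  · exact H.leftOut_nonneg
  · exact H.leftIn_nonneg
  · intro v hv
    rw [show p + q + m - 1 - v = j by omega]
    exact H.left_target (by omega)
  · exact fun hv => H.right_target _ (by omega)
  · exact fun hv => H.rightIn_target (by omega)
  · exact fun hv => H.rightOut_target (by omega)
  · exact fun hv => H.leftOut_target (by omega)
  · exact fun hv => H.leftIn_target (by omega)
  · intro v h1 h2 h3 h4
    have := H.left_step (p + q + m - 1 - (v + 1)) (by omega) (by omega) (by omega) (by omega)
    rwa [show p + q + m - 1 - (v + 1) + 1 = p + q + m - 1 - v by omega] at this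
  · intro v h1 h2 h3 h4
    have := H.right_step (p + q + m - 1 - (v + 1)) (by omega) (by omega) (by omega) (by omega)
    rwa [show p + q + m - 1 - (v + 1) + 1 = p + q + m - 1 - v by omega] at this
  · intro v h1 h2
    have := H.left_second (p + q + m - 1 - m) (by omega) (by omega)
    rwa [show T.left (p + q) = T.left (p + q + m - 1 - v) by congr 1; omega] at this
  · intro v h1 h2
    have := H.right_second (p + q + m - 1 - m) (by omega) (by omega)
    rwa [show T.right (p + q) = T.right (p + q + m - 1 - v) by congr 1; omega] at this
  · intro v h1 h2
    have := H.rightIn_step (p + q + m - 1 - m) (by omega) (by omega)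
    rwa [show T.right (p + q) = T.right (p + q + m - 1 - v) by congr 1; omega,
      add_comm (T.left _)] at this
  · exact fun h => H.rightOut_step _ (by omega) (by omega)
  · exact fun h => H.right_last _ (by omega) (by omega)
  · intro v h1 h2
    have := H.left_first (p + q + m - 1 - (m + q)) (by omega) (by omega)
    rwa [show T.left p = T.left (p + q + m - 1 - v) by congr 1; omega] at this
  · intro v h1 h2
    have := H.right_first (p + q + m - 1 - (m + q)) (by omega) (by omega)
    rwa [show T.right p = T.right (p + q + m - 1 - v) by congr 1; omega] at this
  · intro v h1 h2
    have := H.leftIn_step (p + q + m - 1 - (m + q)) (by omega) (by omega)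
    rwa [show T.right p = T.right (p + q + m - 1 - v) by congr 1; omega,
      add_comm (T.left _)] at this
  · intro v h1 h2
    rw [show p + q + m - 1 - v = 0 by omega]
    exact H.leftOut_step (by omega)
  · intro v h1 h2
    rw [show p + q + m - 1 - v = 0 by omega]
    exact H.left_zero (by omega)

end EdgeTimes

/-- The sum of `F` over the neighbours of `v` in the barbell. -/
def barbellSum (p q m v : ℕ) (F : ℕ → ℝ) : ℝ :=
  (if v < p + q + m then F (v + 1) else 0) + (if 0 < v then F (v - 1) else 0)
    + (if v = 0 then F p else 0) + (if v = p then F 0 else 0)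
    + (if v = p + q then F (p + q + m) else 0) + (if v = p + q + m then F (p + q) else 0)

-- The size bounds make the six adjacency cases mutually exclusive, so the indicator of the
-- disjunction is the sum of the indicators. The guard `0 < v` excludes truncated subtraction.
open scoped Classical in
theorem sum_barbellAdj {p q m : ℕ} (hp : 2 ≤ p) (hq : 1 ≤ q) (hm : 2 ≤ m) {v : ℕ}
    (hv : v < p + q + m + 1) (F : ℕ → ℝ) :
    ∑ w ∈ Finset.range (p + q + m + 1), (if BarbellAdj p q m v w then F w else 0)
      = barbellSum p q m v F := by
  have h1 : ∀ w, (if BarbellAdj p q m v w then F w else 0)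
      = (if w = v + 1 then F w else 0) + (if 0 < v ∧ w = v - 1 then F w else 0)
        + (if v = 0 ∧ w = p then F w else 0) + (if v = p ∧ w = 0 then F w else 0)
        + (if v = p + q ∧ w = p + q + m then F w else 0)
        + (if v = p + q + m ∧ w = p + q then F w else 0) := by
    intro w
    by_cases h : BarbellAdj p q m v w
    · rw [if_pos h]
      rcases h with h | h | h | h | h | h
      · rw [if_pos (by omega), if_neg (by omega), if_neg (by omega),
          if_neg (by omega), if_neg (by omega), if_neg (by omega)]
        simp
      · rw [if_neg (by omega), if_pos (by omega), if_neg (by omega),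
          if_neg (by omega), if_neg (by omega), if_neg (by omega)]
        simp
      · rw [if_neg (by omega), if_neg (by omega), if_pos (by omega),
          if_neg (by omega), if_neg (by omega), if_neg (by omega)]
        simp
      · rw [if_neg (by omega), if_neg (by omega), if_neg (by omega),
          if_pos (by omega), if_neg (by omega), if_neg (by omega)]
        simp
      · rw [if_neg (by omega), if_neg (by omega), if_neg (by omega),
          if_neg (by omega), if_pos (by omega), if_neg (by omega)]
        simp
      · rw [if_neg (by omega), if_neg (by omega), if_neg (by omega),
          if_neg (by omega), if_neg (by omega), if_pos (by omega)]
        simp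
    · rw [if_neg h]
      unfold BarbellAdj at h
      rw [if_neg (by omega), if_neg (by omega), if_neg (by omega),
        if_neg (by omega), if_neg (by omega), if_neg (by omega)]
      simp
  have h2 : ∀ (c : Prop) [Decidable c] (x : ℕ), x < p + q + m + 1 →
      ∑ w ∈ Finset.range (p + q + m + 1), (if c ∧ w = x then F w else 0)
        = if c then F x else 0 := by
    intro c _ x hx
    simp_rw [ite_and]
    split_ifs
    · rw [Finset.sum_ite_eq' , if_pos (Finset.mem_range.2 hx)]
    · simp
  simp_rw [h1, Finset.sum_add_distrib]
  rw [h2 _ _ (by omega), h2 _ _ (by omega), h2 _ _ (by omega), h2 _ _ (by omega),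
    h2 _ _ (by omega), Finset.sum_ite_eq', barbellSum]
  simp only [Finset.mem_range, Nat.add_lt_add_iff_right]

end EdgeTimes
end NBRW

/-! ### From coordinate equations to edge equations. -/

namespace NBRW

section Transfer

variable {p q m : ℕ}

theorem barbellSum_zero (hp : 2 ≤ p) (F : ℕ → ℝ) : barbellSum p q m 0 F = F 1 + F p := by
  unfold barbellSum
  split_ifs <;> first | (exfalso; omega) | simp

theorem barbellSum_first {v : ℕ} (hp : 2 ≤ p) (hq : 1 ≤ q) (hv : v + 1 = p) (F : ℕ → ℝ) :
    barbellSum p q m p F = F (p + 1) + F v + F 0 := by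
  unfold barbellSum
  rw [show p - 1 = v by omega]
  split_ifs <;> first | (exfalso; omega) | simp

theorem barbellSum_second {v : ℕ} (hq : 1 ≤ q) (hm : 2 ≤ m) (hv : v + 1 = p + q) (F : ℕ → ℝ) :
    barbellSum p q m (p + q) F = F (p + q + 1) + F v + F (p + q + m) := by
  unfold barbellSum
  rw [show p + q - 1 = v by omega]
  split_ifs <;> first | (exfalso; omega) | simp

theorem barbellSum_last {v : ℕ} (hm : 2 ≤ m) (hv : v + 1 = p + q + m) (F : ℕ → ℝ) :
    barbellSum p q m (p + q + m) F = F v + F (p + q) := by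
  unfold barbellSum
  rw [show p + q + m - 1 = v by omega]
  split_ifs <;> first | (exfalso; omega) | simp

theorem barbellSum_succ {v : ℕ} (h1 : v + 1 ≠ p) (h2 : v + 1 ≠ p + q) (h3 : v + 1 < p + q + m)
    (F : ℕ → ℝ) : barbellSum p q m (v + 1) F = F (v + 1 + 1) + F v := by
  unfold barbellSum
  rw [show v + 1 - 1 = v by omega]
  split_ifs <;> first | (exfalso; omega) | simp

namespace EdgeTimes

variable (T : EdgeTimes)

theorem time_right (u : ℕ) : T.time p q m u (u + 1) = T.right u := if_pos rfl

theorem time_left (v : ℕ) : T.time p q m (v + 1) v = T.left v := by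
  unfold time
  split_ifs <;> first | (exfalso; omega) | rfl

theorem time_leftIn (hp : 2 ≤ p) : T.time p q m 0 p = T.leftIn := by
  unfold time
  split_ifs <;> first | (exfalso; omega) | rfl

theorem time_leftOut (hp : 2 ≤ p) : T.time p q m p 0 = T.leftOut := by
  unfold time
  split_ifs <;> first | (exfalso; omega) | rfl

theorem time_rightOut (hp : 2 ≤ p) (hm : 2 ≤ m) :
    T.time p q m (p + q) (p + q + m) = T.rightOut := by
  unfold time
  split_ifs <;> first | (exfalso; omega) | rfl

theorem time_rightIn (hp : 2 ≤ p) (hm : 2 ≤ m) :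
    T.time p q m (p + q + m) (p + q) = T.rightIn := by
  unfold time
  split_ifs <;> first | (exfalso; omega) | rfl

theorem sum_time (hp : 2 ≤ p) (hm : 2 ≤ m) :
    ∑ u ∈ Finset.range (p + q + m + 1), barbellSum p q m u (T.time p q m u) = T.total p q m := by
  have hN : 0 < p + q + m := by omega
  simp only [barbellSum, Finset.sum_add_distrib, total]
  rw [Finset.sum_range_succ (fun u => if u < p + q + m then T.time p q m u (u + 1) else 0),
    if_neg (lt_irrefl _),
    Finset.sum_range_succ' (fun u => if 0 < u then T.time p q m u (u - 1) else 0),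
    if_neg (lt_irrefl _), Finset.sum_ite_eq', Finset.sum_ite_eq', Finset.sum_ite_eq',
    Finset.sum_ite_eq']
  simp only [Finset.mem_range]
  rw [if_pos (by omega), if_pos (by omega), if_pos (by omega), if_pos (by omega),
    time_leftIn _ hp, time_leftOut _ hp, time_rightOut _ hp hm, time_rightIn _ hp hm]
  congr 5
  · rw [add_zero]
    exact Finset.sum_congr rfl fun v hv => by
      rw [if_pos (Finset.mem_range.1 hv), time_right]
  · rw [add_zero]
    exact Finset.sum_congr rfl fun v hv => by
      rw [if_pos (Nat.succ_pos v), Nat.add_sub_cancel, time_left]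

variable {T} {j : ℕ}

theorem IsSolution.time_nonneg (H : T.IsSolution p q m j) (hp : 2 ≤ p) (hm : 2 ≤ m) {u v : ℕ}
    (hu : u < p + q + m + 1) (hv : v < p + q + m + 1) (h : BarbellAdj p q m u v) :
    0 ≤ T.time p q m u v := by
  rcases h with rfl | rfl | ⟨rfl, rfl⟩ | ⟨rfl, rfl⟩ | ⟨rfl, rfl⟩ | ⟨rfl, rfl⟩
  · rw [time_right]; exact H.right_nonneg _ (by omega)
  · rw [time_left]; exact H.left_nonneg _ (by omega)
  · rw [time_leftIn _ hp]; exact H.leftIn_nonneg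
  · rw [time_leftOut _ hp]; exact H.leftOut_nonneg
  · rw [time_rightOut _ hp hm]; exact H.rightOut_nonneg
  · rw [time_rightIn _ hp hm]; exact H.rightIn_nonneg

theorem IsSolution.time_target (H : T.IsSolution p q m j) (hp : 2 ≤ p) (hm : 2 ≤ m) {u : ℕ}
    (hu : u < p + q + m + 1) (h : BarbellAdj p q m u j) : T.time p q m u j = 0 := by
  rcases h with rfl | rfl | ⟨rfl, rfl⟩ | ⟨rfl, rfl⟩ | ⟨rfl, rfl⟩ | ⟨rfl, rfl⟩
  · rw [time_right]; exact H.right_target _ rfl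
  · rw [time_left]; exact H.left_target (by omega)
  · rw [time_leftIn _ hp]; exact H.leftIn_target rfl
  · rw [time_leftOut _ hp]; exact H.leftOut_target rfl
  · rw [time_rightOut _ hp hm]; exact H.rightOut_target rfl
  · rw [time_rightIn _ hp hm]; exact H.rightIn_target rfl

/-- `barbellSum` of the constant 1 is the degree, so this is the step equation of `IsEdgeSolution`,
checked by the type of edge and of its head `v`. -/
theorem IsSolution.time_step (H : T.IsSolution p q m j) (hp : 2 ≤ p) (hq : 1 ≤ q) (hm : 2 ≤ m)
    {u v : ℕ} (hu : u < p + q + m + 1) (hv : v < p + q + m + 1) (h : BarbellAdj p q m u v)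
    (hj : v ≠ j) :
    (barbellSum p q m v (fun _ => 1) - 1) * (T.time p q m u v - 1)
      = barbellSum p q m v (T.time p q m v) - T.time p q m v u := by
  obtain ⟨p', hp'⟩ : ∃ p', p' + 1 = p := ⟨p - 1, by omega⟩
  obtain ⟨q', hq'⟩ : ∃ q', q' + 1 = p + q := ⟨p + q - 1, by omega⟩
  obtain ⟨m', hm'⟩ : ∃ m', m' + 1 = p + q + m := ⟨p + q + m - 1, by omega⟩
  have tl : ∀ {x y : ℕ}, x + 1 = y → T.time p q m y x = T.left x := by
    rintro x _ rfl
    exact T.time_left x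
  have tr : ∀ {x y : ℕ}, x + 1 = y → T.time p q m x y = T.right x := by
    rintro x _ rfl
    exact T.time_right x
  rcases h with h | h | ⟨rfl, rfl⟩ | ⟨rfl, rfl⟩ | ⟨rfl, rfl⟩ | ⟨rfl, rfl⟩
  · rw [tr h.symm, tl h.symm]
    by_cases h1 : v = p
    · subst h1
      simp only [barbellSum_first hp hq h.symm]
      rw [time_right, tl h.symm, time_leftOut _ hp, H.right_first u h.symm hj]
      ring
    by_cases h2 : v = p + q
    · subst h2
      simp only [barbellSum_second hq hm h.symm]
      rw [time_right, tl h.symm, time_rightOut _ hp hm, H.right_second u h.symm hj]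
      ring
    by_cases h3 : v = p + q + m
    · subst h3
      simp only [barbellSum_last hm h.symm]
      rw [tl h.symm, time_rightIn _ hp hm, H.right_last u h.symm hj]
      ring
    · subst h
      simp only [barbellSum_succ h1 h2 (show u + 1 < p + q + m by omega)]
      rw [time_right, time_left, H.right_step u hj (by omega) h1 h2]
      ring
  · subst h
    rw [time_left, time_right]
    by_cases h1 : v = p
    · subst h1
      simp only [barbellSum_first hp hq hp']
      rw [time_right, tl hp', time_leftOut _ hp, H.left_first p' hp' hj]
      ring
    by_cases h2 : v = p + q
    · subst h2
      simp only [barbellSum_second hq hm hq']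
      rw [time_right, tl hq', time_rightOut _ hp hm, H.left_second q' hq' hj]
      ring
    rcases Nat.eq_zero_or_pos v with h3 | h3
    · subst h3
      simp only [barbellSum_zero hp]
      rw [tr (zero_add 1), time_leftIn _ hp, H.left_zero hj]
      ring
    · obtain ⟨x, rfl⟩ : ∃ x, v = x + 1 := ⟨v - 1, by omega⟩
      simp only [barbellSum_succ h1 h2 (show x + 1 < p + q + m by omega)]
      rw [time_right, time_left, H.left_step x hj (by omega) h1 h2]
      ring
  · simp only [barbellSum_first hp hq hp']
    rw [time_leftIn _ hp, time_leftOut _ hp, time_right, tl hp', H.leftIn_step p' hp' hj]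
    ring
  · simp only [barbellSum_zero hp]
    rw [time_leftIn _ hp, time_leftOut _ hp, tr (zero_add 1), H.leftOut_step hj]
    ring
  · simp only [barbellSum_last hm hm']
    rw [time_rightOut _ hp hm, time_rightIn _ hp hm, tl hm', H.rightOut_step m' hm' hj]
    ring
  · simp only [barbellSum_second hq hm hq']
    rw [time_rightOut _ hp hm, time_rightIn _ hp hm, time_right, tl hq',
      H.rightIn_step q' hq' hj]
    ring

end EdgeTimes

/-! ### Transfer to graphs on `Fin n`. -/

section Graph

variable {n : ℕ} {G : SimpleGraph (Fin n)}

open scoped Classical in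
theorem sum_neighborFinset_barbell (hp : 2 ≤ p) (hq : 1 ≤ q) (hm : 2 ≤ m)
    (hn : n = p + q + m + 1) (hG : ∀ u v : Fin n, G.Adj u v ↔ BarbellAdj p q m u v)
    (v : Fin n) (F : ℕ → ℝ) :
    ∑ w ∈ G.neighborFinset v, F w = barbellSum p q m v F := by
  subst hn
  rw [← sum_barbellAdj hp hq hm v.2, ← Fin.sum_univ_eq_sum_range
    (fun w => if BarbellAdj p q m v w then F w else 0), ← Finset.sum_filter]
  refine Finset.sum_congr ?_ fun _ _ => rfl
  ext w
  simp [hG]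

open scoped Classical in
theorem degree_barbell (hp : 2 ≤ p) (hq : 1 ≤ q) (hm : 2 ≤ m)
    (hn : n = p + q + m + 1) (hG : ∀ u v : Fin n, G.Adj u v ↔ BarbellAdj p q m u v)
    (v : Fin n) : (G.degree v : ℝ) = 2 + (if (v : ℕ) = p then 1 else 0)
      + (if (v : ℕ) = p + q then 1 else 0) := by
  have h := sum_neighborFinset_barbell hp hq hm hn hG v fun _ => 1
  rw [Finset.sum_const, nsmul_eq_mul, mul_one, G.card_neighborFinset_eq_degree] at h
  rw [h, barbellSum]
  have := v.2
  split_ifs <;> first | (exfalso; omega) | norm_num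

theorem EdgeTimes.IsSolution.isEdgeSolution (hp : 2 ≤ p) (hq : 1 ≤ q) (hm : 2 ≤ m)
    (hn : n = p + q + m + 1) (hG : ∀ u v : Fin n, G.Adj u v ↔ BarbellAdj p q m u v)
    {j : Fin n} {T : EdgeTimes} (H : T.IsSolution p q m j) :
    IsEdgeSolution G j fun u v => T.time p q m u v := by
  classical
  have lt : ∀ v : Fin n, (v : ℕ) < p + q + m + 1 := fun v => hn ▸ v.2
  refine ⟨fun v => ?_, fun u v h => ?_, fun u h => ?_, fun u v h hj => ?_⟩
  · have h := degree_barbell hp hq hm hn hG v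
    have h2 : (2 : ℝ) ≤ G.degree v := by
      rw [h]
      split_ifs <;> norm_num
    exact_mod_cast h2
  · exact H.time_nonneg hp hm (lt u) (lt v) ((hG u v).1 h)
  · exact H.time_target hp hm (lt u) ((hG u j).1 h)
  · have h1 := sum_neighborFinset_barbell hp hq hm hn hG v fun _ => 1
    rw [Finset.sum_const, nsmul_eq_mul, mul_one, G.card_neighborFinset_eq_degree] at h1
    have h2 := sum_neighborFinset_barbell hp hq hm hn hG v (T.time p q m v)
    rw [h1, h2]
    exact H.time_step hp hq hm (lt u) (lt v) ((hG u v).1 h) (fun e => hj (Fin.ext e))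

end Graph
end Transfer
end NBRW

/-! ### Explicit remaining times. -/

namespace NBRW

noncomputable section ExplicitTimes

namespace EdgeTimes

/-- The expected remaining times to the vertex `j < p`. -/
def toCycle (p q m j : ℕ) : EdgeTimes where
  -- An excursion from `p` costs `2 * q` on the path plus `2 * (m + 1)` for two mean turns of the
  -- far cycle. On return to `p` both directions are equally likely, with lengths `j + 1` and `p -
  -- j`, hence the mean `(p + 1) / 2`.
  right v :=
    if v < j then j - v - 1 else if v < p then p - v - 1 + (j + 1) / 2 + q + m + 1 + (p + 1) / 4
    else if v < p + q then 2 * q + p - v - 1 + 2 * (m + 1) + (p + 1) / 2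
    else p + q + m - v + q + (p + 1) / 2 + (m + 1)
  left v := if v < j then v + 1 + (p - j) / 2 + q + m + 1 + (p + 1) / 4 else if v < p then v - j
    else if v < p + q then v - p + (p + 1) / 2
    else v - p + (p + 1) / 2 + (m + 1)
  leftIn := (p - j) / 2 + q + m + 1 + (p + 1) / 4
  leftOut := j
  rightOut := m + q + (p + 1) / 2 + (m + 1)
  rightIn := q + (p + 1) / 2 + (m + 1)

/-- The expected remaining times to the vertex `p`. -/
def toJoint (p q m : ℕ) : EdgeTimes where
  -- A walk already on the far cycle makes one further turn on average, whence the single `m + 1` in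
  -- the later entries.
  right v := if v < p then p - v - 1 else if v < p + q then 2 * q + p - v - 1 + 2 * (m + 1)
    else p + q + m - v + q + (m + 1)
  left v := if v < p then v + 1 else if v < p + q then v - p else v - p + (m + 1)
  leftIn := 0
  leftOut := p
  rightOut := m + q + (m + 1)
  rightIn := q + (m + 1)

/-- The expected remaining times to the vertex `p + s`, where `0 < s < s + t = q`. -/
def toPath (p s t m : ℕ) : EdgeTimes where
  right v := if v < p then 2 * p - v + s else if v < p + s then p + s - v - 1
    else if v < p + s + t then p + s + 2 * t - v - 1 + 2 * (m + 1)
    else p + s + 2 * t + m - v + (m + 1)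
  left v := if v < p then v + 1 + s + (p + 1) else if v < p + s then v - p + 2 * (p + 1) + s
    else if v < p + s + t then v - p - s else v - p - s + (m + 1)
  leftIn := s + (p + 1)
  leftOut := p + s + (p + 1)
  rightOut := m + t + (m + 1)
  rightIn := t + (m + 1)

set_option maxHeartbeats 1000000 in
theorem isSolution_toCycle {p q m j : ℕ} (hq : 1 ≤ q) (hm : 2 ≤ m) (hj : j < p) :
    (toCycle p q m j).IsSolution p q m j := by
  constructor <;> simp only [toCycle] <;> intros <;> (try split_ifs) <;>
    first
    | trivial
    | (exfalso; omega)
    -- Strict inequalities become `+ 1 ≤` before the cast to the reals, which would lose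
    -- integrality.
    | ((try simp only [not_lt] at *); (try simp only [Nat.lt_iff_add_one_le] at *)
       rify at *; linarith)

set_option maxHeartbeats 1000000 in
theorem isSolution_toJoint {p q m : ℕ} (hp : 2 ≤ p) (hq : 1 ≤ q) (hm : 2 ≤ m) :
    (toJoint p q m).IsSolution p q m p := by
  constructor <;> simp only [toJoint] <;> intros <;> (try split_ifs) <;>
    first
    | trivial
    | (exfalso; omega)
    | ((try simp only [not_lt] at *); (try simp only [Nat.lt_iff_add_one_le] at *)
       rify at *; linarith)

set_option maxHeartbeats 1000000 in
theorem isSolution_toPath {p s t m : ℕ} (hp : 2 ≤ p) (hs : 1 ≤ s) (ht : 1 ≤ t) (hm : 2 ≤ m) :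
    (toPath p s t m).IsSolution p (s + t) m (p + s) := by
  constructor <;> simp only [toPath, ← add_assoc] <;> intros <;> (try split_ifs) <;>
    first
    | trivial
    | (exfalso; omega)
    | ((try simp only [not_lt] at *); (try simp only [Nat.lt_iff_add_one_le] at *)
       rify at *; linarith)

end EdgeTimes
end ExplicitTimes
end NBRW

/-! ### Totals over edges and over targets. -/

namespace NBRW

noncomputable section Totals

/-- The sum over directed edges of the expected remaining times to the vertex `j < p`. -/
def cycleTotal (p q m j : ℝ) : ℝ :=
  (j + 1) * (j + (p - j) / 2 + q + m + 1 + (p + 1) / 4)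
    + (p - j) * (p - 1 - j + (j + 1) / 2 + q + m + 1 + (p + 1) / 4)
    + q * (2 * q - 1 + 2 * (m + 1) + (p + 1)) + (m + 1) * (m + 2 * (q + (p + 1) / 2 + (m + 1)))

/-- The sum over directed edges of the expected remaining times to the vertex `p`. -/
def jointTotal (p q m : ℝ) : ℝ :=
  (p + 1) * p + q * (2 * q - 1 + 2 * (m + 1)) + (m + 1) * (m + 2 * (q + (m + 1)))

/-- The sum over directed edges of the expected remaining times to the vertex `p + s`, where
`0 < s < s + t = q`. -/
def pathTotal (p s t m : ℝ) : ℝ :=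
  (p + 1) * (p + 2 * (s + p + 1)) + s * (2 * s - 1 + 2 * (p + 1)) + t * (2 * t - 1 + 2 * (m + 1))
    + (m + 1) * (m + 2 * (t + (m + 1)))

namespace EdgeTimes

theorem sum_range_of_eq {n : ℕ} {f : ℕ → ℝ} {c : ℝ} (h : ∀ x < n, f x = c) :
    ∑ x ∈ Finset.range n, f x = n * c := by
  rw [Finset.sum_congr rfl fun x hx => h x (Finset.mem_range.1 hx), Finset.sum_const,
    Finset.card_range, nsmul_eq_mul]

/-- Along a segment one direction loses 1 per vertex and the other gains 1, so the two values at an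
edge have constant sum. The chords fit the pattern, giving the factors `j + 1` and `m + 1` in
`cycleTotal`. Here `p = j + e`. -/
theorem total_toCycle (q m j e : ℕ) :
    (toCycle (j + e) q m j).total (j + e) q m = cycleTotal (j + e) q m j := by
  unfold total toCycle cycleTotal
  rw [Finset.sum_range_add, Finset.sum_range_add, Finset.sum_range_add,
    sum_range_of_eq (n := j) (c := j + e / 2 + q + m + 1 + (j + e + 1) / 4),
    sum_range_of_eq (n := e) (c := e - 1 + (j + 1) / 2 + q + m + 1 + (j + e + 1) / 4),
    sum_range_of_eq (n := q) (c := 2 * q - 1 + 2 * (m + 1) + (j + e + 1)),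
    sum_range_of_eq (n := m) (c := m + 2 * (q + (j + e + 1) / 2 + (m + 1)))]
  · push_cast
    ring
  all_goals
    intro x hx
    simp only
    split_ifs <;> first | (exfalso; omega) | (push_cast; ring)

theorem total_toJoint (p q m : ℕ) :
    (toJoint p q m).total p q m = jointTotal p q m := by
  unfold total toJoint jointTotal
  rw [Finset.sum_range_add, Finset.sum_range_add,
    sum_range_of_eq (n := p) (c := p),
    sum_range_of_eq (n := q) (c := 2 * q - 1 + 2 * (m + 1)),
    sum_range_of_eq (n := m) (c := m + 2 * (q + (m + 1)))]
  · ring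
  all_goals
    intro x hx
    simp only
    split_ifs <;> first | (exfalso; omega) | (push_cast; ring)

theorem total_toPath (p s t m : ℕ) :
    (toPath p s t m).total p (s + t) m = pathTotal p s t m := by
  unfold total toPath pathTotal
  rw [← add_assoc p s t, Finset.sum_range_add, Finset.sum_range_add, Finset.sum_range_add,
    sum_range_of_eq (n := p) (c := p + 2 * (s + p + 1)),
    sum_range_of_eq (n := s) (c := 2 * s - 1 + 2 * (p + 1)),
    sum_range_of_eq (n := t) (c := 2 * t - 1 + 2 * (m + 1)),
    sum_range_of_eq (n := m) (c := m + 2 * (t + (m + 1)))]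
  · ring
  all_goals
    intro x hx
    simp only
    split_ifs <;> first | (exfalso; omega) | (push_cast; ring)

end EdgeTimes

/-- The sum over directed edges of the expected remaining times to the vertex `j`. -/
def barbellTotal (p q m j : ℕ) : ℝ :=
  if j < p then cycleTotal p q m j else if j = p then jointTotal p q m
  else if j < p + q then pathTotal p (j - p) (p + q - j) m
  else if j = p + q then jointTotal m q p else cycleTotal m q p (p + q + m - j)

theorem exists_isSolution {p q m j : ℕ} (hp : 2 ≤ p) (hq : 1 ≤ q) (hm : 2 ≤ m)
    (hj : j < p + q + m + 1) :
    ∃ T : EdgeTimes, T.IsSolution p q m j ∧ T.total p q m = barbellTotal p q m j := by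
  unfold barbellTotal
  split_ifs with h1 h2 h3 h4
  · obtain ⟨e, rfl⟩ := Nat.exists_eq_add_of_lt h1
    refine ⟨_, EdgeTimes.isSolution_toCycle hq hm h1, ?_⟩
    have := EdgeTimes.total_toCycle q m j (e + 1)
    rw [← add_assoc] at this
    rw [this]
    push_cast
    congr 1
    ring
  · subst h2
    exact ⟨_, EdgeTimes.isSolution_toJoint hp hq hm, EdgeTimes.total_toJoint j q m⟩
  · obtain ⟨s, rfl⟩ : ∃ s, j = p + s := ⟨j - p, by omega⟩
    obtain ⟨t, rfl⟩ : ∃ t, q = s + t := ⟨q - s, by omega⟩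
    refine ⟨_, EdgeTimes.isSolution_toPath (t := t) hp (by omega) (by omega) hm, ?_⟩
    rw [EdgeTimes.total_toPath]
    push_cast
    congr 1 <;> ring
  · subst h4
    have h := (EdgeTimes.isSolution_toJoint hm hq hp).reflect (by omega) (by omega) (by omega)
      (show m ≤ m + q + p by omega)
    rw [show m + q + p - m = p + q by omega] at h
    exact ⟨_, h, by rw [EdgeTimes.total_reflect, EdgeTimes.total_toJoint]⟩
  · obtain ⟨i, e, rfl, rfl⟩ : ∃ i e, m = i + e ∧ j = p + q + e :=
      ⟨p + q + m - j, j - (p + q), by omega, by omega⟩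
    have h := (EdgeTimes.isSolution_toCycle (m := p) hq hp (show i < i + e by omega)).reflect
      (by omega) (by omega) (by omega) (show i ≤ i + e + q + p by omega)
    rw [show i + e + q + p - i = p + q + e by omega] at h
    refine ⟨_, h, ?_⟩
    rw [EdgeTimes.total_reflect, EdgeTimes.total_toCycle]
    push_cast
    congr 1
    ring

/-- The coefficients come from interpolation at 0, 1, 2, so `hf` says that `f` is quadratic and can
be checked by `ring`. -/
theorem sum_range_quadratic {f : ℝ → ℝ} (n : ℕ)
    (hf : ∀ x, f x = f 0 + (4 * f 1 - f 2 - 3 * f 0) / 2 * x + (f 2 - 2 * f 1 + f 0) / 2 * x ^ 2) :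
    ∑ x ∈ Finset.range n, f x = n * f 0 + (4 * f 1 - f 2 - 3 * f 0) / 4 * (n * (n - 1))
      + (f 2 - 2 * f 1 + f 0) / 12 * (n * (n - 1) * (2 * n - 1)) := by
  induction n with
  | zero => simp
  | succ n ih =>
    rw [Finset.sum_range_succ, ih, hf n]
    push_cast
    ring

/-- With path length `q + 1` there are `q` interior targets; the one at offset `x` has distances `x
+ 1` and `q - x` to the joints. -/
theorem sum_barbellTotal (p q m : ℕ) :
    ∑ j ∈ Finset.range (p + (q + 1) + m + 1), barbellTotal p (q + 1) m j
      = ∑ x ∈ Finset.range p, cycleTotal p (q + 1) m x + jointTotal p (q + 1) m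
        + ∑ x ∈ Finset.range q, pathTotal p (x + 1) (q - x) m + jointTotal m (q + 1) p
        + ∑ x ∈ Finset.range m, cycleTotal m (q + 1) p (m - 1 - x) := by
  rw [show p + (q + 1) + m + 1 = p + 1 + q + 1 + m by omega, Finset.sum_range_add,
    Finset.sum_range_succ, Finset.sum_range_add, Finset.sum_range_succ]
  unfold barbellTotal
  congr 1
  · congr 1
    · congr 1
      · congr 1
        · refine Finset.sum_congr rfl fun x hx => ?_
          rw [if_pos (Finset.mem_range.1 hx)]
          push_cast
          rfl
        · rw [if_neg (by omega), if_pos rfl]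
          push_cast
          rfl
      · refine Finset.sum_congr rfl fun x hx => ?_
        have := Finset.mem_range.1 hx
        rw [if_neg (by omega), if_neg (by omega), if_pos (by omega)]
        push_cast
        congr 1 <;> ring
    · rw [if_neg (by omega), if_neg (by omega), if_neg (by omega), if_pos (by omega)]
      push_cast
      rfl
  · refine Finset.sum_congr rfl fun x hx => ?_
    rw [if_neg (by omega), if_neg (by omega), if_neg (by omega), if_neg (by omega)]
    push_cast
    congr 1
    ring

open scoped Classical in
theorem sum_degree_barbell {p q m n : ℕ} {G : SimpleGraph (Fin n)} (hp : 2 ≤ p) (hq : 1 ≤ q)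
    (hm : 2 ≤ m) (hn : n = p + q + m + 1)
    (hG : ∀ u v : Fin n, G.Adj u v ↔ BarbellAdj p q m u v) (F : ℕ → ℝ) :
    ∑ v, (G.degree v : ℝ) * F v
      = 2 * ∑ v ∈ Finset.range (p + q + m + 1), F v + F p + F (p + q) := by
  subst hn
  simp_rw [degree_barbell hp hq hm rfl hG, add_mul, ite_mul, one_mul, zero_mul]
  rw [Fin.sum_univ_eq_sum_range (fun v => 2 * F v + (if v = p then F v else 0)
    + (if v = p + q then F v else 0)), Finset.sum_add_distrib, Finset.sum_add_distrib,
    Finset.sum_ite_eq', Finset.sum_ite_eq', if_pos (Finset.mem_range.2 (by omega)),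
    if_pos (Finset.mem_range.2 (by omega)), Finset.mul_sum]

-- The two extra terms come from the joints, whose degree is 3 instead of 2.
open scoped Classical in
theorem barbell_hittingTimes {p q m n : ℕ} {G : SimpleGraph (Fin n)} (hp : 2 ≤ p) (hq : 1 ≤ q)
    (hm : 2 ≤ m) (hn : n = p + q + m + 1)
    (hG : ∀ u v : Fin n, G.Adj u v ↔ BarbellAdj p q m u v) :
    (∀ i j, expectedHittingTime G i j ≠ ⊤) ∧
    stationary G ⬝ᵥ (hittingMatrix G *ᵥ stationary G)
      = (2 * ∑ j ∈ Finset.range (p + q + m + 1), barbellTotal p q m j + barbellTotal p q m p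
        + barbellTotal p q m (p + q)) / (2 * (p + q + m + 2)) ^ 2 := by
  choose T hT hS using fun j : Fin n => exists_isSolution (j := (j : ℕ)) hp hq hm (by omega)
  have H := fun j : Fin n => (hT j).isEdgeSolution hp hq hm hn hG
  refine ⟨fun i j => (H j).expectedHittingTime_ne_top i, ?_⟩
  have h1 : ∀ j, ∑ u, ∑ w ∈ G.neighborFinset u, (T j).time p q m u w = barbellTotal p q m j := by
    intro j
    simp_rw [sum_neighborFinset_barbell hp hq hm hn hG]
    rw [← hS j, ← EdgeTimes.sum_time _ hp hm, ← Fin.sum_univ_eq_sum_range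
      (fun u => barbellSum p q m u ((T j).time p q m u))]
    subst hn
    rfl
  rw [stationary_hittingMatrix H]
  simp_rw [h1]
  rw [sum_degree_barbell hp hq hm hn hG]
  congr 2
  have h2 := sum_degree_barbell hp hq hm hn hG fun _ => 1
  simp only [mul_one, Finset.sum_const, Finset.card_range, nsmul_eq_mul] at h2
  rw [h2]
  push_cast
  ring

end Totals
end NBRW

/-! ### Evaluation for the cycle barbell. -/

theorem mainTheorem9 (k a b : ℕ) (hk : 2 ≤ k) (ha : 3 ≤ a) (hb : 3 ≤ b) :
    (∀ i j : Fin (a + b + k - 2),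
      NBRW.expectedHittingTime (NBRW.cycleBarbell k a b hk ha hb) i j ≠ ⊤) ∧
    NBRW.stationary (NBRW.cycleBarbell k a b hk ha hb) ⬝ᵥ
        (NBRW.hittingMatrix (NBRW.cycleBarbell k a b hk ha hb) *ᵥ
          NBRW.stationary (NBRW.cycleBarbell k a b hk ha hb)) =
      (13 * (a : ℝ) ^ 3 + 13 * (b : ℝ) ^ 3 + (b : ℝ) ^ 2 * (-87 + 60 * (k : ℝ))
          + (a : ℝ) ^ 2 * (-87 + 60 * (b : ℝ) + 60 * (k : ℝ))
          + 2 * (b : ℝ) * (49 - 72 * (k : ℝ) + 24 * (k : ℝ) ^ 2))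
        / (24 * (-1 + (a : ℝ) + (b : ℝ) + (k : ℝ)) ^ 2)
      + (4 * (-9 + 20 * (k : ℝ) - 15 * (k : ℝ) ^ 2 + 4 * (k : ℝ) ^ 3)
          + 2 * (a : ℝ) * (49 + 30 * (b : ℝ) ^ 2 - 72 * (k : ℝ) + 24 * (k : ℝ) ^ 2
            + 12 * (b : ℝ) * (-7 + 4 * (k : ℝ))))
        / (24 * (-1 + (a : ℝ) + (b : ℝ) + (k : ℝ)) ^ 2) := by
  obtain ⟨p, rfl⟩ : ∃ p, a = p + 1 := ⟨a - 1, by omega⟩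
  obtain ⟨q, rfl⟩ : ∃ q, k = q + 1 + 1 := ⟨k - 2, by omega⟩
  obtain ⟨m, rfl⟩ : ∃ m, b = m + 1 := ⟨b - 1, by omega⟩
  obtain ⟨h1, h2⟩ := NBRW.barbell_hittingTimes (p := p) (q := q + 1) (m := m)
    (G := NBRW.cycleBarbell (q + 1 + 1) (p + 1) (m + 1) hk ha hb)
    (by omega) (by omega) (by omega) (by omega) (fun u v => by
      rw [NBRW.cycleBarbell_adj]
      unfold NBRW.BarbellAdj
      omega)
  refine ⟨h1, h2.trans ?_⟩
  rw [NBRW.sum_barbellTotal,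
    NBRW.sum_range_quadratic (f := fun x => NBRW.cycleTotal p (q + 1) m x) p
      (fun x => by simp only [NBRW.cycleTotal]; ring),
    NBRW.sum_range_quadratic (f := fun x => NBRW.pathTotal p (x + 1) (q - x) m) q
      (fun x => by simp only [NBRW.pathTotal]; ring),
    NBRW.sum_range_quadratic (f := fun x => NBRW.cycleTotal m (q + 1) p (m - 1 - x)) m
      (fun x => by simp only [NBRW.cycleTotal]; ring)]
  have hp : NBRW.barbellTotal p (q + 1) m p = NBRW.jointTotal p (q + 1) m := by
    simp [NBRW.barbellTotal]
  have hR : NBRW.barbellTotal p (q + 1) m (p + (q + 1)) = NBRW.jointTotal m (q + 1) p := by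
    simp [NBRW.barbellTotal]
  rw [hp, hR]
  simp only [NBRW.cycleTotal, NBRW.pathTotal, NBRW.jointTotal]
  push_cast
  -- `ring_nf` absorbs the `-1` in `-1 + a + b + k`, which makes positivity visible.
  rw [← add_div, div_eq_div_iff (by positivity) (by ring_nf; positivity)]
  ring
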